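/- Let $\Lambda$ be a left and right noetherian ring. Let $\operatorname{mod}\Lambda$ denote the category of finitely generated left $\Lambda$-modules, and $\operatorname{mod}\Lambda^{op}$ that of finitely generated right $\Lambda$-modules (left $\Lambda^{op}$-modules). For a left (resp. right) $\Lambda$-module $M$, the groups $\operatorname{Ext}^i_\Lambda(M,\Lambda)$ are taken over $\Lambda$ (resp. $\Lambda^{op}$) and are regarded as right (resp. left) $\Lambda$-modules through the other action of $\Lambda$ on itself. Define $\operatorname{grade} M=\inf\{t\ge 0:\operatorname{Ext}^t_\Lambda(M,\Lambda)\ne 0\}\in\mathbb N\cup\{\infty\}$, and put $(-)^*=\operatorname{Hom}_\Lambda(-,\Lambda)$. For $i\ge 1$, a module $M$ in $\operatorname{mod}\Lambda$ is called $i$-syzygy if there is an exact sequence $0\to M\to Q_0\to Q_1\to\cdots\to Q_{i-1}$ with all $Q_j$ finitely generated projective. It is called $i$-torsionfree if, for an exact sequence $P_1\xrightarrow{f}P_0\to M\to 0$ with $P_0,P_1$ finitely generated projective and $X=\operatorname{Coker}(f^*\colon P_0^*\to P_1^*)$, one has $\operatorname{Ext}^j_\Lambda(X,\Lambda)=0$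 for all $1\le j\le i$ (this does not depend on the choice of the sequence). Let $\Omega^i(\operatorname{mod}\Lambda)$ and $\mathcal T^i(\operatorname{mod}\Lambda)$ be the full subcategories of $\operatorname{mod}\Lambda$ consisting of the $i$-syzygy and of the $i$-torsionfree modules, respectively; define $\Omega^i(\operatorname{mod}\Lambda^{op})$ and $\mathcal T^i(\operatorname{mod}\Lambda^{op})$ in the same way. **Theorem 2.4.** For every positive integer $k$, the following statements are equivalent. 1. $\operatorname{grade}\operatorname{Ext}^{i+1}_\Lambda(M,\Lambda)\ge i$ for every $M\in\operatorname{mod}\Lambda$ and every $1\le i\le k-1$. 2. $\Omega^i(\operatorname{mod}\Lambda)=\mathcal T^i(\operatorname{mod}\Lambda)$ for every $1\le i\le k$. 3. $\operatorname{grade}\operatorname{Ext}^{i+1}_\Lambda(N,\Lambda)\ge i$ for every $N\in\operatorname{mod}\Lambda^{op}$ and every $1\le i\le k-1$. 4. $\Omega^i(\operatorname{mod}\Lambda^{op})=\mathcal T^i(\operatorname{mod}\Lambda^{op})$ for every $1\le i\le k$. -/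

import Mathlib

open CategoryTheory

universe u

namespace SyzygyTorsionfree

/-! Throughout, `A` and `B` are rings and `D` is an abelian group with commuting left actions of
`A` and `B`. The two cases of interest are `D = Λ` with `(A, B) = (Λ, Λᵐᵒᵖ)` (left modules) and
`D = Λ` with `(A, B) = (Λᵐᵒᵖ, Λ)` (right modules, regarded as left `Λᵐᵒᵖ`-modules); `Λ` acts on
itself by left multiplication and `Λᵐᵒᵖ` acts on `Λ` by right multiplication. -/

section Definitions

variable (A B D : Type u) [Ring A] [Ring B] [AddCommGroup D] [Module A D] [Module B D]

/-- The abelian group `Ext_A^i(M, D)`. -/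
def ExtGroup (M : Type u) [AddCommGroup M] [Module A M] (i : ℕ) : Type u :=
  Abelian.Ext (ModuleCat.of A M) (ModuleCat.of A D) i

noncomputable instance (M : Type u) [AddCommGroup M] [Module A M] (i : ℕ) :
    AddCommGroup (ExtGroup A D M i) :=
  inferInstanceAs (AddCommGroup (Abelian.Ext (ModuleCat.of A M) (ModuleCat.of A D) i))

variable {B} in
/-- The action of `b : B` on `D`, as an endomorphism of the `A`-module `D`. -/
def actionHom [SMulCommClass A B D] (b : B) : ModuleCat.of A D ⟶ ModuleCat.of A D :=
  ModuleCat.ofHom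
    { toFun := fun x => b • x
      map_add' := smul_add b
      map_smul' := fun a x => (smul_comm a b x).symm }

variable {B} in
/-- The action of `b : B` on `Ext_A^i(M, D)` by functoriality in `D`: composition with the
`A`-linear endomorphism `x ↦ b • x` of `D`. -/
noncomputable def extAction [SMulCommClass A B D] (M : Type u) [AddCommGroup M] [Module A M]
    (i : ℕ) (b : B) (e : Abelian.Ext (ModuleCat.of A M) (ModuleCat.of A D) i) :
    Abelian.Ext (ModuleCat.of A M) (ModuleCat.of A D) i :=
  e.comp (Abelian.Ext.mk₀ (actionHom A D b)) (add_zero i)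

section ExtAction

variable [SMulCommClass A B D] (M : Type u) [AddCommGroup M] [Module A M] (i : ℕ)
  (e e' : Abelian.Ext (ModuleCat.of A M) (ModuleCat.of A D) i)

theorem one_extAction : extAction A D M i (1 : B) e = e := by
  have h : actionHom A D (1 : B) = 𝟙 (ModuleCat.of A D) := by
    ext x; exact one_smul B x
  rw [extAction, h, Abelian.Ext.comp_mk₀_id]

variable {B} in
theorem mul_extAction (b c : B) :
    extAction A D M i (b * c) e = extAction A D M i b (extAction A D M i c e) := by
  have h : actionHom A D (b * c) = actionHom A D c ≫ actionHom A D b := by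
    ext x; exact mul_smul b c x
  rw [extAction, extAction, extAction, h, ← Abelian.Ext.mk₀_comp_mk₀,
    Abelian.Ext.comp_assoc_of_second_deg_zero]

variable {B} in
theorem extAction_zero (b : B) : extAction A D M i b 0 = 0 := by
  rw [extAction, Abelian.Ext.zero_comp]

variable {B} in
theorem extAction_add (b : B) :
    extAction A D M i b (e + e') = extAction A D M i b e + extAction A D M i b e' :=
  Abelian.Ext.add_comp _ _ _ _

variable {B} in
theorem add_extAction (b c : B) :
    extAction A D M i (b + c) e = extAction A D M i b e + extAction A D M i c e := by
  have h : actionHom A D (b + c) = actionHom A D b + actionHom A D c := by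
    ext x; exact add_smul b c x
  rw [extAction, extAction, extAction, h, Abelian.Ext.mk₀_add, Abelian.Ext.comp_add]

theorem zero_extAction : extAction A D M i (0 : B) e = 0 := by
  have h : actionHom A D (0 : B) = 0 := by
    ext x; exact zero_smul B x
  rw [extAction, h, Abelian.Ext.mk₀_zero, Abelian.Ext.comp_zero]

/-- `Ext_A^i(M, D)` is a `B`-module by functoriality in `D`. -/
noncomputable instance : Module B (ExtGroup A D M i) where
  smul b e := extAction A D M i b e
  one_smul := one_extAction A B D M i
  mul_smul b c e := mul_extAction A D M i e b c
  smul_zero b := extAction_zero A D M i b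
  smul_add b e e' := extAction_add A D M i e e' b
  add_smul b c e := add_extAction A D M i e b c
  zero_smul := zero_extAction A B D M i

end ExtAction

/-- The grade of `M`: the least `t` with `Ext_A^t(M, D) ≠ 0`, and `∞` if there is none. -/
noncomputable def extGrade (M : Type u) [AddCommGroup M] [Module A M] : ℕ∞ :=
  ⨅ (t : ℕ) (_ : Nontrivial (ExtGroup A D M t)), (t : ℕ∞)

/-- `M` is a `k`-syzygy module: there is an exact sequence `0 → M → Q₀ → Q₁ → ⋯ → Q_{k-1}` with
all `Q_j` finitely generated projective. (Only the terms `Q_j` with `j < k` matter.) -/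
def IsSyzygy (k : ℕ) (M : Type u) [AddCommGroup M] [Module A M] : Prop :=
  ∃ (Q : ℕ → ModuleCat.{u} A) (ι : M →ₗ[A] Q 0) (d : ∀ j, Q j →ₗ[A] Q (j + 1)),
    (∀ j < k, Module.Finite A (Q j) ∧ Module.Projective A (Q j)) ∧
    Function.Injective ι ∧
    (1 < k → Function.Exact ι (d 0)) ∧
    (∀ j, j + 2 < k → Function.Exact (d j) (d (j + 1)))

variable {A} in
/-- The transpose `f^* : Q^* → P^*`, `g ↦ g ∘ f`, of `f : P → Q`, where `(-)^* = Hom_A(-, D)`;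
it is `B`-linear. -/
def dualMap [SMulCommClass A B D] {P Q : Type u} [AddCommGroup P] [Module A P]
    [AddCommGroup Q] [Module A Q] (f : P →ₗ[A] Q) : (Q →ₗ[A] D) →ₗ[B] (P →ₗ[A] D) where
  toFun g := g ∘ₗ f
  map_add' _ _ := rfl
  map_smul' _ _ := rfl

/-- `M` is a `k`-torsionfree module: there is an exact sequence `P₁ → P₀ → M → 0` of `A`-modules,
with `f : P₁ → P₀` and with `P₀` and `P₁` finitely generated projective, such that the `B`-module
`X = Coker (f^* : P₀^* → P₁^*)` satisfies `Ext_B^i(X, D) = 0` for all `1 ≤ i ≤ k`. -/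
def IsTorsionfree [SMulCommClass A B D] (k : ℕ) (M : Type u) [AddCommGroup M] [Module A M] :
    Prop :=
  ∃ (P₁ P₀ : ModuleCat.{u} A) (f : P₁ →ₗ[A] P₀) (p : P₀ →ₗ[A] M),
    Module.Finite A P₁ ∧ Module.Projective A P₁ ∧
    Module.Finite A P₀ ∧ Module.Projective A P₀ ∧
    Function.Exact f p ∧ Function.Surjective p ∧
    ∀ i : ℕ, 1 ≤ i → i ≤ k →
      Subsingleton (ExtGroup B D ((P₁ →ₗ[A] D) ⧸ (dualMap B D f).range) i)

/-- `Ω^k(mod A)`: the full subcategory of finitely generated `A`-modules that are `k`-syzygy. -/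
def syzygies (k : ℕ) : ObjectProperty (ModuleCat.{u} A) :=
  fun M => Module.Finite A M ∧ IsSyzygy A k M

/-- `T^k(mod A)`: the full subcategory of finitely generated `A`-modules that are
`k`-torsionfree. -/
def torsionfrees [SMulCommClass A B D] (k : ℕ) : ObjectProperty (ModuleCat.{u} A) :=
  fun M => Module.Finite A M ∧ IsTorsionfree A B D k M

end Definitions

end SyzygyTorsionfree

/-! Left and right modules are treated at once: `D` is free over `A` and over `B` on a common
generator, and `hD.symm` exchanges the two sides. Write `M^*` for the dual into `D`; finitely
generated projectives are reflexive.

Torsionfree modules are always syzygies: dualizing a cover of `M^*` embeds a `(k+1)`-torsionfree `M`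
in a projective with `k`-torsionfree cokernel (`IsTorsionfree.exists_embedding`). For the converse,
let `0 → M → Q → N → 0` be exact with `Q` finitely generated projective and `N` `i`-torsionfree. A
transpose `Y` of `M` has `Ext^1(Y) = 0` and `Ext^{j+2}(Y) ≃ Ext^j(Ext^1(N))` for `j < i`, so `M` is
`(i+1)`-torsionfree exactly when `Ext^1(N)` has grade at least `i` (`isTorsionfree_succ_iff`). By
dimension shifting, the `Ext^1` of `i`-fold syzygies are the groups `Ext^{i+1}(-)`; induction then
gives the equivalence on each side.

For the symmetry (`ExtGradeCondition.symm`), the lower conditions already give `S = Ext^1(N)` grade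
at least `j - 1` when `N` is a `j`-fold syzygy. The remaining group `Ext^{j-1}(S)` is `Ext^{j+1}(Y)`
for a module `Y` on the other side, so it has grade at least `j` by hypothesis. Such a group must
vanish (`ext_subsingleton_of_grade`), because its identity map is zero. -/

namespace SyzygyTorsionfree

/-! ### Vanishing of Ext as the second argument varies -/

section ExtLayer

variable {A : Type u} [Ring A]

/-- The short complex attached to two composable linear maps. -/
abbrev sesOf {K P X : Type u} [AddCommGroup K] [Module A K] [AddCommGroup P] [Module A P]
    [AddCommGroup X] [Module A X] (i : K →ₗ[A] P) (p : P →ₗ[A] X) (h : Function.Exact i p) :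
    ShortComplex (ModuleCat.{u} A) :=
  ShortComplex.mk (ModuleCat.ofHom i) (ModuleCat.ofHom p) (by
    ext x; exact (h _).2 ⟨x, rfl⟩)

theorem sesOf_shortExact {K P X : Type u} [AddCommGroup K] [Module A K] [AddCommGroup P]
    [Module A P] [AddCommGroup X] [Module A X] {i : K →ₗ[A] P} {p : P →ₗ[A] X}
    (hi : Function.Injective i) (h : Function.Exact i p) (hp : Function.Surjective p) :
    (sesOf i p h).ShortExact :=
  ModuleCat.shortComplex_shortExact _ h hi hp

/-- `Ext_A^n(W, Z)` for modules. -/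
abbrev EX (A : Type u) [Ring A] (W Z : Type u) [AddCommGroup W] [Module A W] [AddCommGroup Z]
    [Module A Z] (n : ℕ) : Type u :=
  Abelian.Ext (ModuleCat.of A W) (ModuleCat.of A Z) n

theorem EX_subsingleton_quotient {K P X W : Type u} [AddCommGroup K] [Module A K]
    [AddCommGroup P] [Module A P] [AddCommGroup X] [Module A X] [AddCommGroup W] [Module A W]
    {i : K →ₗ[A] P} {p : P →ₗ[A] X}
    (hi : Function.Injective i) (h : Function.Exact i p) (hp : Function.Surjective p) (m : ℕ)
    (h1 : Subsingleton (EX A W P m)) (h2 : Subsingleton (EX A W K (m + 1))) :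
    Subsingleton (EX A W X m) := by
  refine ⟨fun a b => ?_⟩
  have key : ∀ a : EX A W X m, a = 0 := fun a => by
    obtain ⟨x, rfl⟩ := Abelian.Ext.covariant_sequence_exact₃ (ModuleCat.of A W)
      (sesOf_shortExact hi h hp) a rfl (h2.elim _ _)
    rw [show x = 0 from h1.elim _ _, Abelian.Ext.zero_comp]
  rw [key a, key b]

theorem EX_zero_subsingleton_iff {W Z : Type u} [AddCommGroup W] [Module A W] [AddCommGroup Z]
    [Module A Z] : Subsingleton (EX A W Z 0) ↔ Subsingleton (W →ₗ[A] Z) :=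
  (Abelian.Ext.homEquiv₀.trans ModuleCat.homEquiv).subsingleton_congr

theorem EX_subsingleton_of_projective {W Z : Type u} [AddCommGroup W] [Module A W]
    [AddCommGroup Z] [Module A Z] [Module.Projective A W] (n : ℕ) :
    Subsingleton (EX A W Z (n + 1)) := by
  have : Projective (ModuleCat.of A W) := inferInstance
  exact Abelian.Ext.subsingleton_of_projective _ _ _

/-- The identity of `Z` is a sum of maps through `D`, so every class is a sum of classes pushed
through the zero group `Ext^m(W, D)`. This passes vanishing from `D` to finitely generated
projectives. -/
theorem EX_subsingleton_of_retracts {W Z D : Type u} [AddCommGroup W] [Module A W]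
    [AddCommGroup Z] [Module A Z] [AddCommGroup D] [Module A D] {n m : ℕ}
    (φ : Fin n → (Z →ₗ[A] D)) (ψ : Fin n → (D →ₗ[A] Z))
    (h : ∑ i, ψ i ∘ₗ φ i = LinearMap.id) (hD : Subsingleton (EX A W D m)) :
    Subsingleton (EX A W Z m) := by
  have key : ∀ a : EX A W Z m, a = 0 := fun a => by
    rw [← Abelian.Ext.comp_mk₀_id a]
    have : 𝟙 (ModuleCat.of A Z) = ∑ i, (ModuleCat.ofHom (φ i) ≫ ModuleCat.ofHom (ψ i)) := by
      ext x
      have := congrArg (fun f => f x) h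
      simpa [ModuleCat.hom_sum] using this.symm
    rw [this, Abelian.Ext.mk₀_sum, Abelian.Ext.comp_sum]
    refine Finset.sum_eq_zero fun i _ => ?_
    rw [← Abelian.Ext.mk₀_comp_mk₀, ← Abelian.Ext.comp_assoc_of_second_deg_zero,
      show a.comp (Abelian.Ext.mk₀ (ModuleCat.ofHom (φ i))) (add_zero m) = 0 from hD.elim _ _,
      Abelian.Ext.zero_comp]
  exact ⟨fun a b => by rw [key a, key b]⟩

end ExtLayer

/-! ### Linear functoriality in the first argument, connecting maps and dimension shifting -/

section ExtFunctor

variable {A D : Type u} (B : Type u) [Ring A] [Ring B] [AddCommGroup D] [Module A D] [Module B D]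
  [SMulCommClass A B D]

/-- Pullback `Ext_A^n(N, D) → Ext_A^n(M, D)` along `f : M → N`, a `B`-linear map. -/
noncomputable def extPull {M N : Type u} [AddCommGroup M] [Module A M] [AddCommGroup N]
    [Module A N] (f : M →ₗ[A] N) (n : ℕ) : ExtGroup A D N n →ₗ[B] ExtGroup A D M n where
  toFun (e : EX A N D n) := ((Abelian.Ext.mk₀ (ModuleCat.ofHom f)).comp e (zero_add n) : EX A M D n)
  map_add' _ _ := Abelian.Ext.comp_add _ _ _ _
  map_smul' b e :=
    (Abelian.Ext.comp_assoc_of_third_deg_zero (Abelian.Ext.mk₀ (ModuleCat.ofHom f)) (e : EX A N D n)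
      (Abelian.Ext.mk₀ (actionHom A D b)) (zero_add n)).symm

theorem extPull_id {M : Type u} [AddCommGroup M] [Module A M] (n : ℕ) (e : ExtGroup A D M n) :
    extPull B LinearMap.id n e = e :=
  Abelian.Ext.mk₀_id_comp (X := ModuleCat.of A M) (Y := ModuleCat.of A D) e

theorem extPull_comp {M N L : Type u} [AddCommGroup M] [Module A M] [AddCommGroup N]
    [Module A N] [AddCommGroup L] [Module A L] (f : M →ₗ[A] N) (g : N →ₗ[A] L) (n : ℕ)
    (e : ExtGroup A D L n) : extPull B (g ∘ₗ f) n e = extPull B f n (extPull B g n e) :=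
  (Abelian.Ext.mk₀_comp_mk₀_assoc (ModuleCat.ofHom f) (ModuleCat.ofHom g) (n := n)
    (α := (e : EX A L D n))).symm

theorem extPull_add {M N : Type u} [AddCommGroup M] [Module A M] [AddCommGroup N]
    [Module A N] (f g : M →ₗ[A] N) (n : ℕ) (e : ExtGroup A D N n) :
    extPull B (f + g) n e = extPull B f n e + extPull B g n e := by
  have h : ModuleCat.ofHom (f + g) = ModuleCat.ofHom f + ModuleCat.ofHom g := rfl
  change Abelian.Ext.comp (Abelian.Ext.mk₀ (ModuleCat.ofHom (f + g))) (e : EX A N D n)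
    (zero_add n) = _
  rw [h, Abelian.Ext.mk₀_add]
  exact Abelian.Ext.add_comp _ _ _ _

/-- Linear equivalences of modules induce linear equivalences of the Ext groups. -/
noncomputable def extCongr {M N : Type u} [AddCommGroup M] [Module A M] [AddCommGroup N]
    [Module A N] (f : M ≃ₗ[A] N) (n : ℕ) : ExtGroup A D M n ≃ₗ[B] ExtGroup A D N n :=
  { extPull B f.symm.toLinearMap n with
    invFun := extPull B f.toLinearMap n
    left_inv := fun e => by
      change extPull B f.toLinearMap n (extPull B f.symm.toLinearMap n e) = e
      rw [← extPull_comp, LinearEquiv.comp_coe, LinearEquiv.self_trans_symm]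
      exact extPull_id B n e
    right_inv := fun e => by
      change extPull B f.symm.toLinearMap n (extPull B f.toLinearMap n e) = e
      rw [← extPull_comp, LinearEquiv.comp_coe, LinearEquiv.symm_trans_self]
      exact extPull_id B n e }

variable {K P X : Type u} [AddCommGroup K] [Module A K] [AddCommGroup P] [Module A P]
  [AddCommGroup X] [Module A X] {i : K →ₗ[A] P} {p : P →ₗ[A] X}
  (hi : Function.Injective i) (h : Function.Exact i p) (hp : Function.Surjective p)

/-- The connecting map `Ext_A^n(K, D) → Ext_A^{n+1}(X, D)` of a short exact sequence
`0 → K → P → X → 0`. -/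
noncomputable def extConn (n : ℕ) : ExtGroup A D K n →ₗ[B] ExtGroup A D X (n + 1) where
  toFun (e : EX A K D n) :=
    ((sesOf_shortExact hi h hp).extClass.comp e (add_comm 1 n) : EX A X D (n + 1))
  map_add' _ _ := Abelian.Ext.comp_add _ _ _ _
  map_smul' b e :=
    (Abelian.Ext.comp_assoc_of_third_deg_zero (sesOf_shortExact hi h hp).extClass (e : EX A K D n)
      (Abelian.Ext.mk₀ (actionHom A D b)) (add_comm 1 n)).symm

theorem exists_extPull_of_extConn {n : ℕ} (e : ExtGroup A D K n)
    (he : extConn B hi h hp n e = 0) : ∃ x : ExtGroup A D P n, extPull B i n x = e :=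
  Abelian.Ext.contravariant_sequence_exact₁ (sesOf_shortExact hi h hp) (ModuleCat.of A D) e
    (add_comm 1 n) he

theorem exists_extConn_of_extPull {n : ℕ} (e : ExtGroup A D X (n + 1))
    (he : extPull B p (n + 1) e = 0) : ∃ x : ExtGroup A D K n, extConn B hi h hp n x = e :=
  Abelian.Ext.contravariant_sequence_exact₃ (sesOf_shortExact hi h hp) (ModuleCat.of A D) e
    he (add_comm 1 n)

theorem extConn_extPull {n : ℕ} (e : ExtGroup A D P n) :
    extConn B hi h hp n (extPull B i n e) = 0 :=
  (sesOf_shortExact hi h hp).extClass_comp_assoc (γ := (e : EX A P D n)) (h := add_comm 1 n)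

theorem extConn_injective {n : ℕ} (hP : Subsingleton (ExtGroup A D P n)) :
    Function.Injective (extConn (D := D) B hi h hp n) := by
  rw [injective_iff_map_eq_zero]
  intro e he
  obtain ⟨x, rfl⟩ := exists_extPull_of_extConn B hi h hp e he
  rw [hP.elim x 0, map_zero]

theorem extConn_surjective {n : ℕ} (hP : Subsingleton (ExtGroup A D P (n + 1))) :
    Function.Surjective (extConn (D := D) B hi h hp n) := fun e =>
  exists_extConn_of_extPull B hi h hp e (hP.elim _ _)

instance [Module.Projective A P] (n : ℕ) : Subsingleton (ExtGroup A D P (n + 1)) :=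
  EX_subsingleton_of_projective n

/-- Dimension shifting. -/
noncomputable def extShift [Module.Projective A P] (n : ℕ) :
    ExtGroup A D K (n + 1) ≃ₗ[B] ExtGroup A D X (n + 2) :=
  LinearEquiv.ofBijective (extConn B hi h hp (n + 1))
    ⟨extConn_injective B hi h hp inferInstance, extConn_surjective B hi h hp inferInstance⟩

/-- `Hom_A(M, D) ≃ Ext_A^0(M, D)`. -/
noncomputable def homExtEquiv (M : Type u) [AddCommGroup M] [Module A M] :
    (M →ₗ[A] D) ≃ₗ[B] ExtGroup A D M 0 where
  toFun f := (Abelian.Ext.mk₀ (ModuleCat.ofHom f) : EX A M D 0)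
  map_add' f g := Abelian.Ext.mk₀_add (ModuleCat.ofHom f) (ModuleCat.ofHom g)
  map_smul' b f := (Abelian.Ext.mk₀_comp_mk₀ (ModuleCat.ofHom f) (actionHom A D b)).symm
  invFun e := (Abelian.Ext.homEquiv₀ (e : EX A M D 0)).hom
  left_inv f := by
    change (Abelian.Ext.homEquiv₀ (Abelian.Ext.homEquiv₀.symm (ModuleCat.ofHom f))).hom = f
    rw [Equiv.apply_symm_apply]
    rfl
  right_inv e := Abelian.Ext.mk₀_homEquiv₀_apply (X := ModuleCat.of A M) (Y := ModuleCat.of A D) e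

theorem extPull_homExtEquiv {M N : Type u} [AddCommGroup M] [Module A M] [AddCommGroup N]
    [Module A N] (f : M →ₗ[A] N) (g : N →ₗ[A] D) :
    extPull B f 0 (homExtEquiv B N g) = homExtEquiv B M (g ∘ₗ f) :=
  Abelian.Ext.mk₀_comp_mk₀ (ModuleCat.ofHom f) (ModuleCat.ofHom g)

/-- The connecting map `Hom_A(K, D) → Ext_A^1(X, D)`. -/
noncomputable def homConn : (K →ₗ[A] D) →ₗ[B] ExtGroup A D X 1 :=
  extConn B hi h hp 0 ∘ₗ (homExtEquiv B K).toLinearMap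

theorem homConn_eq_zero_iff (g : K →ₗ[A] D) :
    homConn B hi h hp g = 0 ↔ ∃ g' : P →ₗ[A] D, g' ∘ₗ i = g := by
  constructor
  · intro hg
    obtain ⟨x, hx⟩ := exists_extPull_of_extConn B hi h hp _ hg
    obtain ⟨g', rfl⟩ := (homExtEquiv B P).surjective x
    rw [extPull_homExtEquiv] at hx
    exact ⟨g', (homExtEquiv B K).injective hx⟩
  · rintro ⟨g', rfl⟩
    change extConn B hi h hp 0 (homExtEquiv B K _) = 0
    rw [← extPull_homExtEquiv, extConn_extPull]

theorem homConn_surjective [Module.Projective A P] :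
    Function.Surjective (homConn (D := D) B hi h hp) :=
  (extConn_surjective B hi h hp inferInstance).comp (homExtEquiv B K).surjective

variable (D) in
include B hi h hp in
theorem ext_one_subsingleton_iff [Module.Projective A P] :
    Subsingleton (ExtGroup A D X 1) ↔ ∀ g : K →ₗ[A] D, ∃ g' : P →ₗ[A] D, g' ∘ₗ i = g := by
  constructor
  · intro hX g
    exact (homConn_eq_zero_iff B hi h hp g).1 (hX.elim _ _)
  · intro hg
    refine subsingleton_of_forall_eq 0 fun e => ?_
    obtain ⟨g, rfl⟩ := homConn_surjective B hi h hp e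
    exact (homConn_eq_zero_iff B hi h hp g).2 (hg g)

end ExtFunctor

section Grade

variable {A D : Type u} [Ring A] [AddCommGroup D] [Module A D]

theorem le_extGrade_iff {M : Type u} [AddCommGroup M] [Module A M] (i : ℕ) :
    (i : ℕ∞) ≤ extGrade A D M ↔ ∀ t < i, Subsingleton (ExtGroup A D M t) := by
  simp only [extGrade, le_iInf_iff, Nat.cast_le]
  constructor
  · intro h t ht
    by_contra hn
    exact absurd (h t (not_subsingleton_iff_nontrivial.1 hn)) (by omega)
  · intro h t ht
    by_contra hn
    exact (not_subsingleton_iff_nontrivial.2 ht) (h t (by omega))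

end Grade

/-! ### Dual bases and reflexivity of finitely generated projectives -/

theorem exists_dual_basis (A P : Type u) [Ring A] [AddCommGroup P] [Module A P]
    [Module.Finite A P] [Module.Projective A P] :
    ∃ (n : ℕ) (x : Fin n → P) (φ : Fin n → (P →ₗ[A] A)), ∀ y, ∑ i, φ i y • x i = y := by
  obtain ⟨n, q, hq⟩ := Module.Finite.exists_fin' A P
  obtain ⟨s, hs⟩ := Module.projective_lifting_property q LinearMap.id hq
  refine ⟨n, fun i => q (Pi.single i 1), fun i => LinearMap.proj i ∘ₗ s, fun y => ?_⟩
  have h := congrArg (fun f => f y) hs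
  simp only [LinearMap.comp_apply, LinearMap.id_apply] at h
  conv_rhs => rw [← h, ← Finset.univ_sum_single (s y), map_sum]
  refine Finset.sum_congr rfl fun i _ => ?_
  rw [← map_smul, ← Pi.single_smul, smul_eq_mul, mul_one]
  rfl

theorem finite_projective_of_dual_basis {A P : Type u} [Ring A] [AddCommGroup P] [Module A P]
    {n : ℕ} (x : Fin n → P) (φ : Fin n → (P →ₗ[A] A)) (h : ∀ y, ∑ i, φ i y • x i = y) :
    Module.Finite A P ∧ Module.Projective A P := by
  have hs : (Fintype.linearCombination A x) ∘ₗ (LinearMap.pi φ) = LinearMap.id := by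
    ext y
    simpa [Fintype.linearCombination_apply] using h y
  refine ⟨Module.Finite.of_surjective (Fintype.linearCombination A x) fun y =>
    ⟨LinearMap.pi φ y, congrArg (fun f => f y) hs⟩, Module.Projective.of_split _ _ hs⟩

/-- `D` is, over each of the noetherian rings `A` and `B`, free on one and the same element. -/
structure IsDualizing (A B D : Type u) [Ring A] [Ring B] [AddCommGroup D] [Module A D]
    [Module B D] : Prop where
  exists_generator : ∃ e : D, Function.Bijective (fun a : A => a • e) ∧
    Function.Bijective (fun b : B => b • e)
  left_noetherian : IsNoetherianRing A
  right_noetherian : IsNoetherianRing B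

theorem IsDualizing.symm {A B D : Type u} [Ring A] [Ring B] [AddCommGroup D] [Module A D]
    [Module B D] (h : IsDualizing A B D) : IsDualizing B A D :=
  ⟨let ⟨e, h1, h2⟩ := h.exists_generator; ⟨e, h2, h1⟩, h.right_noetherian, h.left_noetherian⟩

theorem IsDualizing.exists_equiv {A B D : Type u} [Ring A] [Ring B] [AddCommGroup D] [Module A D]
    [Module B D] (h : IsDualizing A B D) :
    ∃ (e : D) (α : A ≃ₗ[A] D) (β : B ≃ₗ[B] D), (∀ a, α a = a • e) ∧ (∀ b, β b = b • e) := by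
  obtain ⟨e, h1, h2⟩ := h.exists_generator
  exact ⟨e, LinearEquiv.ofBijective (LinearMap.toSpanSingleton A D e) h1,
    LinearEquiv.ofBijective (LinearMap.toSpanSingleton B D e) h2, fun _ => rfl, fun _ => rfl⟩

section Torsionless

variable {A : Type u} (D : Type u) [Ring A] [AddCommGroup D] [Module A D]

/-- The linear maps `M → D` separate the points of `M`. -/
def IsTorsionless (M : Type u) [AddCommGroup M] [Module A M] : Prop :=
  ∀ x : M, (∀ g : M →ₗ[A] D, g x = 0) → x = 0

variable {D}

theorem IsTorsionless.of_injective {M N : Type u} [AddCommGroup M] [Module A M]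
    [AddCommGroup N] [Module A N] (h : IsTorsionless (A := A) D N) (f : M →ₗ[A] N)
    (hf : Function.Injective f) : IsTorsionless (A := A) D M := fun x hx =>
  hf (by rw [map_zero]; exact h _ fun g => hx (g ∘ₗ f))

end Torsionless

section Duality

variable {A B D : Type u} [Ring A] [Ring B] [AddCommGroup D] [Module A D] [Module B D]
  [SMulCommClass A B D] [SMulCommClass B A D]

variable (B D) in
/-- The evaluation map `M → M^**`. -/
def evalMap (M : Type u) [AddCommGroup M] [Module A M] : M →ₗ[A] ((M →ₗ[A] D) →ₗ[B] D) where
  toFun x := { toFun := fun g => g x, map_add' := fun _ _ => rfl, map_smul' := fun _ _ => rfl }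
  map_add' x y := by ext g; exact map_add g x y
  map_smul' a x := by ext g; exact map_smul g a x

@[simp] theorem evalMap_apply (M : Type u) [AddCommGroup M] [Module A M] (x : M)
    (g : M →ₗ[A] D) : evalMap B D M x g = g x := rfl

omit [SMulCommClass B A D] in
@[simp] theorem dualMap_apply {P Q : Type u} [AddCommGroup P] [Module A P] [AddCommGroup Q]
    [Module A Q] (f : P →ₗ[A] Q) (g : Q →ₗ[A] D) : dualMap B D f g = g ∘ₗ f := rfl

variable (hD : IsDualizing A B D) (P : Type u) [AddCommGroup P] [Module A P]
  [Module.Finite A P] [Module.Projective A P]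

include hD

/-- A dual basis `(x i, φ i)` of `P` gives the dual basis `(φ i, evaluation at x i)` of `P^*`. The
common generator `e` and the commuting actions let scalars pass from one ring to the other. -/
theorem dual_finite_projective :
    Module.Finite B (P →ₗ[A] D) ∧ Module.Projective B (P →ₗ[A] D) := by
  obtain ⟨e, α, β, hα, hβ⟩ := hD.exists_equiv
  obtain ⟨n, x, φ, h⟩ := exists_dual_basis A P
  refine finite_projective_of_dual_basis (fun i => α.toLinearMap ∘ₗ φ i)
    (fun i => β.symm.toLinearMap ∘ₗ evalMap B D P (x i)) fun g => ?_
  ext y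
  conv_rhs => rw [← h y, map_sum]
  rw [LinearMap.sum_apply]
  refine Finset.sum_congr rfl fun i _ => ?_
  change β.symm (g (x i)) • α (φ i y) = _
  rw [hα, smul_comm, ← hβ, LinearEquiv.apply_symm_apply, map_smul]

omit [SMulCommClass A B D] [SMulCommClass B A D] in
theorem exists_retracts : ∃ (n : ℕ) (φ : Fin n → (P →ₗ[A] D)) (ψ : Fin n → (D →ₗ[A] P)),
    ∑ i, ψ i ∘ₗ φ i = LinearMap.id := by
  obtain ⟨e, α, β, hα, hβ⟩ := hD.exists_equiv
  obtain ⟨n, x, φ, h⟩ := exists_dual_basis A P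
  refine ⟨n, fun i => α.toLinearMap ∘ₗ φ i,
    fun i => LinearMap.toSpanSingleton A P (x i) ∘ₗ α.symm.toLinearMap, ?_⟩
  ext y
  simpa using h y

omit [SMulCommClass A B D] [SMulCommClass B A D] in
theorem isTorsionless_of_projective : IsTorsionless (A := A) D P := by
  obtain ⟨n, φ, ψ, h⟩ := exists_retracts hD P
  intro x hx
  have := congrArg (fun f => f x) h
  simpa [hx] using this.symm

theorem evalMap_injective : Function.Injective (evalMap (A := A) B D P) := by
  rw [injective_iff_map_eq_zero]
  exact fun x hx => isTorsionless_of_projective hD P x fun g => LinearMap.congr_fun hx g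

theorem evalMap_surjective : Function.Surjective (evalMap (A := A) B D P) := by
  obtain ⟨e, α, β, hα, hβ⟩ := hD.exists_equiv
  obtain ⟨n, x, φ, h⟩ := exists_dual_basis A P
  intro Φ
  -- `Φ` is determined by its values on the dual generators, which serve as coordinates of the
  -- preimage.
  refine ⟨∑ i, α.symm (Φ (α.toLinearMap ∘ₗ φ i)) • x i, ?_⟩
  ext g
  have hg : g = ∑ i, β.symm (g (x i)) • (α.toLinearMap ∘ₗ φ i) := by
    ext y
    conv_lhs => rw [← h y, map_sum]
    rw [LinearMap.sum_apply]
    refine Finset.sum_congr rfl fun i _ => ?_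
    change _ = β.symm (g (x i)) • α (φ i y)
    rw [hα, smul_comm, ← hβ, LinearEquiv.apply_symm_apply, map_smul]
  rw [evalMap_apply, map_sum]
  conv_rhs => rw [hg, map_sum]
  refine Finset.sum_congr rfl fun i _ => ?_
  rw [map_smul, map_smul]
  conv_lhs => rw [← β.apply_symm_apply (g (x i)), hβ, smul_comm, ← hα, α.apply_symm_apply]

omit [SMulCommClass A B D] [SMulCommClass B A D] in
theorem EX_subsingleton_projective {W : Type u} [AddCommGroup W] [Module A W] {m : ℕ}
    (h : Subsingleton (ExtGroup A D W m)) : Subsingleton (EX A W P m) := by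
  obtain ⟨n, φ, ψ, hφ⟩ := exists_retracts hD P
  exact EX_subsingleton_of_retracts φ ψ hφ h

end Duality

/-! ### Transposes and independence of the presentation -/

section Transpose

variable {A : Type u} (B D : Type u) [Ring A] [Ring B] [AddCommGroup D] [Module A D] [Module B D]
  [SMulCommClass A B D]

/-- The cokernel of `f^* : P₀^* → P₁^*`. -/
abbrev Transpose {P₁ P₀ : Type u} [AddCommGroup P₁] [Module A P₁] [AddCommGroup P₀] [Module A P₀]
    (f : P₁ →ₗ[A] P₀) : Type u :=
  (P₁ →ₗ[A] D) ⧸ (dualMap B D f).range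

/-- `Ext_B^i(Coker f^*, D) = 0` for `1 ≤ i ≤ k`. -/
def TransposeVanishing {P₁ P₀ : Type u} [AddCommGroup P₁] [Module A P₁] [AddCommGroup P₀]
    [Module A P₀] (f : P₁ →ₗ[A] P₀) (k : ℕ) : Prop :=
  ∀ i : ℕ, 1 ≤ i → i ≤ k → Subsingleton (ExtGroup B D (Transpose B D f) i)

variable {B D}

omit [SMulCommClass A B D] in
theorem extPull_eq_zero_of_factor [SMulCommClass B A D] {M N P : Type u} [AddCommGroup M]
    [Module B M] [AddCommGroup N] [Module B N] [AddCommGroup P] [Module B P]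
    [Module.Projective B P] (f : M →ₗ[B] P) (g : P →ₗ[B] N) (n : ℕ) (e : ExtGroup B D N (n + 1)) :
    extPull A (g ∘ₗ f) (n + 1) e = 0 := by
  rw [extPull_comp, Subsingleton.elim (extPull A g (n + 1) e) 0, map_zero]

/-- The map on transposes induced by a commutative square. -/
def transposeMap {P₁ P₀ Q₁ Q₀ : Type u} [AddCommGroup P₁] [Module A P₁] [AddCommGroup P₀]
    [Module A P₀] [AddCommGroup Q₁] [Module A Q₁] [AddCommGroup Q₀] [Module A Q₀]
    (f : P₁ →ₗ[A] P₀) (g : Q₁ →ₗ[A] Q₀) (a₁ : P₁ →ₗ[A] Q₁) (a₀ : P₀ →ₗ[A] Q₀)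
    (h : g ∘ₗ a₁ = a₀ ∘ₗ f) : Transpose B D g →ₗ[B] Transpose B D f :=
  Submodule.mapQ _ _ (dualMap B D a₁) (by
    rintro _ ⟨φ, rfl⟩
    refine ⟨φ ∘ₗ a₀, ?_⟩
    change (φ ∘ₗ a₀) ∘ₗ f = (φ ∘ₗ g) ∘ₗ a₁
    rw [LinearMap.comp_assoc, LinearMap.comp_assoc, h])

/-- Comparison maps between the two presentations induce maps of transposes whose composite is the
identity plus a map factoring through the projective `P₁^*`. Positive Ext groups do not see the
latter, so those of one transpose are retracts of those of the other. -/
theorem TransposeVanishing.of_presentation [SMulCommClass B A D] (hD : IsDualizing A B D)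
    {P₁ P₀ Q₁ Q₀ M : Type u} [AddCommGroup P₁] [Module A P₁] [AddCommGroup P₀]
    [Module A P₀] [AddCommGroup Q₁] [Module A Q₁] [AddCommGroup Q₀] [Module A Q₀]
    [AddCommGroup M] [Module A M]
    [Module.Projective A P₀] [Module.Finite A P₁] [Module.Projective A P₁]
    [Module.Projective A Q₀] [Module.Projective A Q₁]
    {f : P₁ →ₗ[A] P₀} {p : P₀ →ₗ[A] M} {g : Q₁ →ₗ[A] Q₀} {q : Q₀ →ₗ[A] M}
    (hf : Function.Exact f p) (hp : Function.Surjective p) (hg : Function.Exact g q)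
    (hq : Function.Surjective q) {k : ℕ} (h : TransposeVanishing B D g k) :
    TransposeVanishing B D f k := by
  have lift : ∀ {R S T N : Type u} [AddCommGroup R] [Module A R] [AddCommGroup S] [Module A S]
      [AddCommGroup T] [Module A T] [AddCommGroup N] [Module A N] [Module.Projective A R]
      (u : S →ₗ[A] T) (v : T →ₗ[A] N) (_ : Function.Exact u v) (w : R →ₗ[A] T) (_ : v ∘ₗ w = 0),
      ∃ t : R →ₗ[A] S, u ∘ₗ t = w := by
    intro R S T N _ _ _ _ _ _ _ _ _ u v huv w hw
    obtain ⟨t, ht⟩ := Module.projective_lifting_property u.rangeRestrict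
      (w.codRestrict u.range fun x => (huv _).1 (congrArg (fun f => f x) hw))
      u.surjective_rangeRestrict
    refine ⟨t, ?_⟩
    ext x
    exact congrArg (fun f => ((f x : u.range) : T)) ht
  obtain ⟨a₀, ha₀⟩ := Module.projective_lifting_property q p hq
  obtain ⟨b₀, hb₀⟩ := Module.projective_lifting_property p q hp
  obtain ⟨a₁, ha₁⟩ := lift g q hg (a₀ ∘ₗ f) (by
    rw [← LinearMap.comp_assoc, ha₀, hf.linearMap_comp_eq_zero])
  obtain ⟨b₁, hb₁⟩ := lift f p hf (b₀ ∘ₗ g) (by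
    rw [← LinearMap.comp_assoc, hb₀, hg.linearMap_comp_eq_zero])
  obtain ⟨s, hs⟩ := lift f p hf (b₀ ∘ₗ a₀ - LinearMap.id) (by
    rw [LinearMap.comp_sub, ← LinearMap.comp_assoc, hb₀, ha₀, LinearMap.comp_id, sub_self])
  -- What the homotopy `s` leaves of `b₁ ∘ a₁ - id`. It is killed by `f`, so `t^*` descends to the
  -- transpose, while `(s ∘ f)^*` lands in the image of `f^*` and disappears there.
  set t := b₁ ∘ₗ a₁ - LinearMap.id - s ∘ₗ f with ht
  have hft : f ∘ₗ t = 0 := by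
    rw [ht, LinearMap.comp_sub, LinearMap.comp_sub, ← LinearMap.comp_assoc, hb₁,
      ← LinearMap.comp_assoc, hs, LinearMap.comp_assoc, ha₁, LinearMap.comp_id,
      LinearMap.sub_comp, LinearMap.id_comp, LinearMap.comp_assoc, sub_self]
  obtain ⟨_, _⟩ := dual_finite_projective hD P₁
  let τ : Transpose B D f →ₗ[B] (P₁ →ₗ[A] D) := Submodule.liftQ _ (dualMap B D t) (by
    rintro _ ⟨φ, rfl⟩
    change (φ ∘ₗ f) ∘ₗ t = 0
    rw [LinearMap.comp_assoc, hft, LinearMap.comp_zero])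
  have key : transposeMap f g a₁ a₀ ha₁ ∘ₗ transposeMap g f b₁ b₀ hb₁ =
      LinearMap.id + (dualMap B D f).range.mkQ ∘ₗ τ := by
    apply Submodule.linearMap_qext
    ext φ
    change (dualMap B D f).range.mkQ ((φ ∘ₗ b₁) ∘ₗ a₁) =
      (dualMap B D f).range.mkQ φ + (dualMap B D f).range.mkQ (φ ∘ₗ t)
    rw [← map_add]
    refine (Submodule.Quotient.eq _).2 ⟨φ ∘ₗ s, ?_⟩
    rw [dualMap_apply, ht]
    ext x
    simp only [LinearMap.comp_apply, LinearMap.sub_apply, LinearMap.add_apply, map_sub,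
      LinearMap.id_apply]
    abel
  intro i hi hik
  obtain ⟨j, rfl⟩ : ∃ j, i = j + 1 := ⟨i - 1, by omega⟩
  refine subsingleton_of_forall_eq 0 fun e => ?_
  have h1 : extPull A (LinearMap.id + (dualMap B D f).range.mkQ ∘ₗ τ) (j + 1) e = e := by
    rw [extPull_add, extPull_eq_zero_of_factor, extPull_id, add_zero]
  rw [← h1, ← key, extPull_comp,
    (h (j + 1) hi hik).elim (extPull A (transposeMap f g a₁ a₀ ha₁) (j + 1) e) 0, map_zero]

end Transpose

/-! ### Syzygies one step at a time -/

section IteratedSyzygy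

/-- `M` is an `n`-fold iterated syzygy: either `n = 0`, or there is an exact sequence
`0 → M → Q → N → 0` with `Q` finitely generated projective and `N` an `(n - 1)`-fold one. -/
def IterSyzygy (A : Type u) [Ring A] : ℕ → ModuleCat.{u} A → Prop
  | 0, _ => True
  | n + 1, M => ∃ (Q N : ModuleCat.{u} A) (ι : M →ₗ[A] Q) (π : Q →ₗ[A] N),
      Module.Finite A Q ∧ Module.Projective A Q ∧ Function.Injective ι ∧ Function.Exact ι π ∧
      Function.Surjective π ∧ IterSyzygy A n N

/-- Exactness embeds the cokernel of `ι` in `Q 1`, and the tail of the sequence exhibits it as a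
syzygy of one order less. -/
theorem iterSyzygy_of_isSyzygy {A : Type u} [Ring A] (n : ℕ) : ∀ (M : ModuleCat.{u} A),
    IsSyzygy A (n + 1) M → IterSyzygy A (n + 1) M := by
  induction n with
  | zero =>
    rintro M ⟨Q, ι, d, hQ, hι, -, -⟩
    exact ⟨Q 0, ModuleCat.of A (Q 0 ⧸ ι.range), ι, ι.range.mkQ, (hQ 0 (by omega)).1,
      (hQ 0 (by omega)).2, hι, LinearMap.exact_map_mkQ_range ι, Submodule.mkQ_surjective _,
      trivial⟩
  | succ n ih =>
    rintro M ⟨Q, ι, d, hQ, hι, h0, hd⟩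
    have h0 := h0 (by omega)
    refine ⟨Q 0, ModuleCat.of A (Q 0 ⧸ ι.range), ι, ι.range.mkQ, (hQ 0 (by omega)).1,
      (hQ 0 (by omega)).2, hι, LinearMap.exact_map_mkQ_range ι, Submodule.mkQ_surjective _,
      ih _ ⟨fun j => Q (j + 1), ι.range.liftQ (d 0) ?_, fun j => d (j + 1), ?_, ?_, ?_, ?_⟩⟩
    · exact (LinearMap.exact_iff.1 h0).ge
    · exact fun j hj => hQ (j + 1) (by omega)
    · exact LinearMap.ker_eq_bot.1 (Submodule.ker_liftQ_eq_bot _ _ _ (LinearMap.exact_iff.1 h0).le)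
    · intro hn
      have := hd 0 (by omega)
      rw [LinearMap.exact_iff] at this ⊢
      rw [Submodule.range_liftQ]
      exact this
    · exact fun j hj => hd (j + 1) (by omega)

theorem isSyzygy_of_iterSyzygy {A : Type u} [Ring A] (n : ℕ) : ∀ (M : ModuleCat.{u} A),
    IterSyzygy A (n + 1) M → IsSyzygy A (n + 1) M := by
  induction n with
  | zero =>
    rintro M ⟨Q, N, ι, π, hQ, hQ', hι, -, -, -⟩
    exact ⟨fun _ => Q, ι, fun _ => 0, fun _ _ => ⟨hQ, hQ'⟩, hι, fun h => absurd h (by omega),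
      fun j h => absurd h (by omega)⟩
  | succ n ih =>
    rintro M ⟨Q, N, ι, π, hQ, hQ', hι, hιπ, hπ, hN⟩
    obtain ⟨R, κ, d, hR, hκ, h0, hd⟩ := ih N hN
    refine ⟨fun j => Nat.casesOn j Q R, ι,
      fun j => Nat.casesOn j (κ ∘ₗ π) d, ?_, hι, ?_, ?_⟩
    · rintro (_ | j) hj
      · exact ⟨hQ, hQ'⟩
      · exact hR j (by omega)
    · intro _
      rw [LinearMap.exact_iff] at hιπ ⊢
      rw [← hιπ]
      exact LinearMap.ker_comp_of_ker_eq_bot _ (LinearMap.ker_eq_bot.2 hκ)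
    · rintro (_ | j) hj
      · have := h0 (by omega)
        rw [LinearMap.exact_iff] at this ⊢
        exact this.trans (LinearMap.range_comp_of_range_eq_top _ (LinearMap.range_eq_top.2 hπ)).symm
      · exact hd j (by omega)

theorem IterSyzygy.pred {A : Type u} [Ring A] (n : ℕ) : ∀ (M : ModuleCat.{u} A),
    IterSyzygy A (n + 1) M → IterSyzygy A n M := by
  induction n with
  | zero => exact fun _ _ => trivial
  | succ n ih =>
    rintro M ⟨Q, N, ι, π, hQ, hQ', hι, hιπ, hπ, hN⟩
    exact ⟨Q, N, ι, π, hQ, hQ', hι, hιπ, hπ, ih N hN⟩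

end IteratedSyzygy

theorem exists_equiv_of_surjective {R U V W : Type u} [Ring R] [AddCommGroup U] [Module R U]
    [AddCommGroup V] [Module R V] [AddCommGroup W] [Module R W] (f : U →ₗ[R] V) (g : U →ₗ[R] W)
    (hf : Function.Surjective f) (hg : Function.Surjective g) (h : ∀ x, f x = 0 ↔ g x = 0) :
    Nonempty (V ≃ₗ[R] W) :=
  ⟨(f.quotKerEquivOfSurjective hf).symm ≪≫ₗ Submodule.quotEquivOfEq _ _ (by ext x; exact h x) ≪≫ₗ
    g.quotKerEquivOfSurjective hg⟩

theorem exact_subtype_mkQ {R M : Type u} [Ring R] [AddCommGroup M] [Module R M]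
    (N : Submodule R M) : Function.Exact N.subtype N.mkQ := by
  rw [LinearMap.exact_iff, Submodule.ker_mkQ, Submodule.range_subtype]

theorem exists_projective_cover (A : Type u) [Ring A] (M : Type u) [AddCommGroup M]
    [Module A M] [Module.Finite A M] : ∃ (P : ModuleCat.{u} A) (p : P →ₗ[A] M),
      Module.Finite A P ∧ Module.Projective A P ∧ Function.Surjective p := by
  obtain ⟨n, q, hq⟩ := Module.Finite.exists_fin' A M
  exact ⟨ModuleCat.of A (Fin n → A), q, inferInstanceAs (Module.Finite A (Fin n → A)),
    inferInstanceAs (Module.Projective A (Fin n → A)), hq⟩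

/-! ### Torsionfree modules are syzygies -/

section Torsionfree

variable {A B D : Type u} [Ring A] [Ring B] [AddCommGroup D] [Module A D] [Module B D]
  [SMulCommClass A B D] [SMulCommClass B A D] (hD : IsDualizing A B D)

include hD

section Presentation

variable {P₁ P₀ M : Type u} [AddCommGroup P₁] [Module A P₁] [AddCommGroup P₀] [Module A P₀]
  [AddCommGroup M] [Module A M] [Module.Finite A P₁] [Module.Projective A P₁]
  [Module.Finite A P₀] [Module.Projective A P₀] {f : P₁ →ₗ[A] P₀} {p : P₀ →ₗ[A] M}

-- `P₁^*` is projective with quotient the transpose, so `Ext^1` obstructs extending functionals from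
-- the image of `f^*` to `P₁^*`; by reflexivity the functionals on `P₁^*` are evaluations.
omit [Module.Finite A P₀] [Module.Projective A P₀] in
theorem transpose_ext_one_subsingleton_iff : Subsingleton (ExtGroup B D (Transpose B D f) 1) ↔
    ∀ g : (dualMap B D f).range →ₗ[B] D, ∃ y : P₁,
      evalMap B D P₁ y ∘ₗ (dualMap B D f).range.subtype = g := by
  obtain ⟨_, _⟩ := dual_finite_projective hD P₁
  rw [ext_one_subsingleton_iff D A (Submodule.injective_subtype (dualMap B D f).range)
    (exact_subtype_mkQ _) (Submodule.mkQ_surjective _)]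
  refine forall_congr' fun g => ⟨?_, fun ⟨y, hy⟩ => ⟨_, hy⟩⟩
  rintro ⟨g', hg⟩
  obtain ⟨y, rfl⟩ := evalMap_surjective hD P₁ g'
  exact ⟨y, hg⟩

/-- A functional on the image of `f^*`, pulled back to `P₀^*`, is evaluation at some `x`. It kills
every `φ ∘ p`, so `p x = 0` and `x` comes from `P₁`. -/
theorem transposeVanishing_one_of_isTorsionless (hf : Function.Exact f p)
    (hM : IsTorsionless (A := A) D M) :
    TransposeVanishing B D f 1 := by
  intro i h1 h2
  obtain rfl : i = 1 := by omega
  rw [transpose_ext_one_subsingleton_iff hD]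
  intro g
  obtain ⟨x, hx⟩ := evalMap_surjective hD P₀ (g ∘ₗ (dualMap B D f).rangeRestrict)
  have hpx : p x = 0 := hM _ fun φ => by
    have h := LinearMap.congr_fun hx (φ ∘ₗ p)
    have h0 : (dualMap B D f).rangeRestrict (φ ∘ₗ p) = 0 := by
      apply Subtype.ext
      change (φ ∘ₗ p) ∘ₗ f = 0
      rw [LinearMap.comp_assoc, hf.linearMap_comp_eq_zero, LinearMap.comp_zero]
    rw [LinearMap.comp_apply, h0, map_zero] at h
    exact h
  obtain ⟨y, rfl⟩ := (hf x).1 hpx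
  refine ⟨y, ?_⟩
  ext ⟨_, φ, rfl⟩
  exact LinearMap.congr_fun hx φ

end Presentation

theorem isTorsionfree_iff {P₁ P₀ M : Type u} [AddCommGroup P₁] [Module A P₁] [AddCommGroup P₀]
    [Module A P₀] [AddCommGroup M] [Module A M] [Module.Finite A P₁] [Module.Projective A P₁]
    [Module.Finite A P₀] [Module.Projective A P₀] {f : P₁ →ₗ[A] P₀} {p : P₀ →ₗ[A] M}
    (hf : Function.Exact f p) (hp : Function.Surjective p) (k : ℕ) :
    IsTorsionfree A B D k M ↔ TransposeVanishing B D f k := by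
  constructor
  · rintro ⟨Q₁, Q₀, g, q, _, _, _, _, hg, hq, h⟩
    exact TransposeVanishing.of_presentation hD hf hp hg hq h
  · exact fun h => ⟨ModuleCat.of A P₁, ModuleCat.of A P₀, f, p, ‹_›, ‹_›, ‹_›, ‹_›, hf, hp, h⟩

theorem IsTorsionfree.exists_embedding {M : Type u} [AddCommGroup M] [Module A M] {k : ℕ}
    (hM : IsTorsionfree A B D (k + 1) M) :
    ∃ (Q N : ModuleCat.{u} A) (ι : M →ₗ[A] Q) (π : Q →ₗ[A] N),
      Module.Finite A Q ∧ Module.Projective A Q ∧ Function.Injective ι ∧ Function.Exact ι π ∧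
      Function.Surjective π ∧ IsTorsionfree A B D k N := by
  obtain ⟨P₁, P₀, f, p, _, _, _, _, hf, hp, h⟩ := hM
  have := hD.right_noetherian
  obtain ⟨_, _⟩ := dual_finite_projective hD P₁
  obtain ⟨_, _⟩ := dual_finite_projective hD P₀
  -- This kernel is `M^*`, finitely generated since `B` is noetherian; `F^*` is the projective that
  -- will receive `M`.
  obtain ⟨F, g, _, _, hg⟩ := exists_projective_cover B (dualMap B D f).ker
  obtain ⟨_, _⟩ := dual_finite_projective hD.symm F
  let γ : F →ₗ[B] (P₀ →ₗ[A] D) := (dualMap B D f).ker.subtype ∘ₗ g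
  let u : P₀ →ₗ[A] (F →ₗ[B] D) := dualMap A D γ ∘ₗ evalMap B D P₀
  have hγ : ∀ φ : P₀ →ₗ[A] D, φ ∘ₗ f = 0 → ∃ z, γ z = φ := fun φ hφ => by
    obtain ⟨z, hz⟩ := hg ⟨φ, hφ⟩
    exact ⟨z, congrArg Subtype.val hz⟩
  have hγf : ∀ z y, γ z (f y) = 0 := fun z y => LinearMap.congr_fun (g z).2 y
  -- Vanishing of `Ext^1` enters here: if `u x = 0`, evaluation at `x` kills the kernel of `f^*`,
  -- hence descends to its image and is evaluation at some `y`, so that `x = f y`.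
  have hker : ∀ x, u x = 0 ↔ p x = 0 := by
    intro x
    rw [hf x]
    constructor
    · intro hx
      let K := (dualMap B D f).range
      have hle : (dualMap B D f).ker ≤ (evalMap B D P₀ x).ker := fun φ hφ => by
        obtain ⟨z, rfl⟩ := hγ φ hφ
        exact LinearMap.congr_fun hx z
      let e := (dualMap B D f).quotKerEquivRange
      obtain ⟨y, hy⟩ := (transpose_ext_one_subsingleton_iff hD).1 (h 1 le_rfl (by omega))
        ((dualMap B D f).ker.liftQ (evalMap B D P₀ x) hle ∘ₗ e.symm.toLinearMap)
      refine ⟨y, evalMap_injective hD P₀ ?_⟩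
      ext φ
      have := LinearMap.congr_fun hy (e ((dualMap B D f).ker.mkQ φ))
      simp only [LinearMap.comp_apply, LinearEquiv.coe_coe, LinearEquiv.symm_apply_apply] at this
      exact this
    · rintro ⟨y, rfl⟩
      ext z
      exact hγf z y
  have hle : p.ker ≤ u.ker := fun x hx => (hker x).2 hx
  let ι : M →ₗ[A] (F →ₗ[B] D) := p.ker.liftQ u hle ∘ₗ
    (p.quotKerEquivOfSurjective hp).symm.toLinearMap
  have hι : ∀ x, ι (p x) = u x := fun x => by
    have : (p.quotKerEquivOfSurjective hp).symm (p x) = p.ker.mkQ x := by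
      rw [LinearEquiv.symm_apply_eq]
      rfl
    exact congrArg (p.ker.liftQ u hle) this
  have hinj : Function.Injective ι := by
    rw [injective_iff_map_eq_zero]
    intro m hm
    obtain ⟨x, rfl⟩ := hp m
    rwa [hι, hker] at hm
  have hrange : ι.range = u.range := by
    ext v
    constructor
    · rintro ⟨m, rfl⟩
      obtain ⟨x, rfl⟩ := hp m
      exact ⟨x, (hι x).symm⟩
    · rintro ⟨x, rfl⟩
      exact ⟨p x, hι x⟩
  refine ⟨ModuleCat.of A (F →ₗ[B] D), ModuleCat.of A ((F →ₗ[B] D) ⧸ u.range), ι, u.range.mkQ,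
    ‹_›, ‹_›, hinj, ?_, Submodule.mkQ_surjective _, ?_⟩
  · rw [LinearMap.exact_iff, Submodule.ker_mkQ, hrange]
  · rw [isTorsionfree_iff hD (LinearMap.exact_map_mkQ_range u) (Submodule.mkQ_surjective _)]
    intro i h1 h2
    obtain ⟨j, rfl⟩ : ∃ j, i = j + 1 := ⟨i - 1, by omega⟩
    -- The image of `u^*` is the kernel of `f^*`, so the transpose of `u` is the image of `f^*`, a
    -- first syzygy of the transpose of `f`. This costs one degree of vanishing.
    obtain ⟨e⟩ := exists_equiv_of_surjective (dualMap B D u).range.mkQ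
      (dualMap B D f).rangeRestrict (Submodule.mkQ_surjective _)
      (LinearMap.surjective_rangeRestrict _) (fun φ => by
        rw [Submodule.mkQ_apply, Submodule.Quotient.mk_eq_zero]
        constructor
        · rintro ⟨Φ, rfl⟩
          obtain ⟨z, rfl⟩ := evalMap_surjective hD.symm F Φ
          apply Subtype.ext
          ext y
          exact hγf z (y : P₁)
        · intro hφ
          obtain ⟨z, rfl⟩ := hγ φ (congrArg Subtype.val hφ)
          exact ⟨evalMap A D F z, rfl⟩)
    have e' := (extCongr (D := D) A e (j + 1)).trans
      (extShift A (Submodule.injective_subtype (dualMap B D f).range)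
        (exact_subtype_mkQ _) (Submodule.mkQ_surjective _) j)
    exact e'.toEquiv.subsingleton_congr.2 (h (j + 2) (by omega) (by omega))

theorem IsTorsionfree.iterSyzygy (k : ℕ) : ∀ (M : ModuleCat.{u} A),
    IsTorsionfree A B D k M → IterSyzygy A k M := by
  induction k with
  | zero => exact fun _ _ => trivial
  | succ k ih =>
    intro M hM
    obtain ⟨Q, N, ι, π, h1, h2, h3, h4, h5, h6⟩ := hM.exists_embedding hD
    exact ⟨Q, N, ι, π, h1, h2, h3, h4, h5, ih N h6⟩

end Torsionfree

/-! ### `Ext^1` inside a transpose, and its own Ext groups -/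

section ExtOne

variable {A B D : Type u} [Ring A] [Ring B] [AddCommGroup D] [Module A D] [Module B D]
  [SMulCommClass A B D]
  {P₂ P₁ P₀ L : Type u} [AddCommGroup P₂] [Module A P₂] [AddCommGroup P₁] [Module A P₁]
  [AddCommGroup P₀] [Module A P₀] [AddCommGroup L] [Module A L]
  {f₂ : P₂ →ₗ[A] P₁} {f₁ : P₁ →ₗ[A] P₀} {p : P₀ →ₗ[A] L}

variable (B D) in
/-- For a complex `P₂ → P₁ → P₀`, the map from `Coker (P₀^* → P₁^*)` onto the image of
`P₁^* → P₂^*`. -/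
def transposeToRange (h : Function.Exact f₂ f₁) :
    Transpose B D f₁ →ₗ[B] (dualMap B D f₂).range :=
  (dualMap B D f₁).range.liftQ (dualMap B D f₂).rangeRestrict (by
    rintro _ ⟨φ, rfl⟩
    apply Subtype.ext
    change (φ ∘ₗ f₁) ∘ₗ f₂ = 0
    rw [LinearMap.comp_assoc, h.linearMap_comp_eq_zero, LinearMap.comp_zero])

theorem transposeToRange_surjective (h : Function.Exact f₂ f₁) :
    Function.Surjective (transposeToRange B D h) := fun y => by
  obtain ⟨φ, rfl⟩ := LinearMap.surjective_rangeRestrict _ y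
  exact ⟨(dualMap B D f₁).range.mkQ φ, rfl⟩

/-- Both sides are quotients of the dual of the image of `f₁`, by the functionals that extend to
`P₀`. -/
theorem exists_extOne_equiv [Module.Projective A P₀] (h₂ : Function.Exact f₂ f₁)
    (h₁ : Function.Exact f₁ p) (hp : Function.Surjective p) :
    Nonempty (ExtGroup A D L 1 ≃ₗ[B] (transposeToRange B D h₂).ker) := by
  have hs : Function.Exact f₁.range.subtype p := by
    rw [LinearMap.exact_iff, Submodule.range_subtype]
    exact LinearMap.exact_iff.1 h₁
  let σ : (f₁.range →ₗ[A] D) →ₗ[B] (transposeToRange B D h₂).ker :=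
    LinearMap.codRestrict _ ((dualMap B D f₁).range.mkQ ∘ₗ dualMap B D f₁.rangeRestrict)
      fun g => by
        apply Subtype.ext
        ext x
        change g (f₁.rangeRestrict (f₂ x)) = 0
        rw [show f₁.rangeRestrict (f₂ x) = 0 from Subtype.ext ((h₂ _).2 ⟨x, rfl⟩), map_zero]
  refine exists_equiv_of_surjective (homConn B (Submodule.injective_subtype f₁.range) hs hp) σ
    (homConn_surjective B _ _ _) ?_ fun g => ?_
  · rintro ⟨x, hx⟩
    obtain ⟨φ, rfl⟩ := Submodule.mkQ_surjective _ x
    have hφ : φ ∘ₗ f₂ = 0 := congrArg Subtype.val hx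
    have hle : f₁.ker ≤ φ.ker := fun y hy => by
      obtain ⟨z, rfl⟩ := (h₂ y).1 hy
      exact LinearMap.congr_fun hφ z
    refine ⟨f₁.ker.liftQ φ hle ∘ₗ f₁.quotKerEquivRange.symm.toLinearMap, ?_⟩
    apply Subtype.ext
    refine congrArg (dualMap B D f₁).range.mkQ ?_
    ext y
    have : f₁.quotKerEquivRange.symm (f₁.rangeRestrict y) = f₁.ker.mkQ y := by
      rw [LinearEquiv.symm_apply_eq]
      rfl
    exact congrArg (f₁.ker.liftQ φ hle) this
  · rw [homConn_eq_zero_iff]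
    have : σ g = 0 ↔ g ∘ₗ f₁.rangeRestrict ∈ (dualMap B D f₁).range := by
      rw [← Submodule.Quotient.mk_eq_zero, ← Submodule.coe_eq_zero]
      rfl
    rw [this]
    refine exists_congr fun g' => ?_
    constructor
    · rintro rfl
      rfl
    · intro h
      ext ⟨_, y, rfl⟩
      exact LinearMap.congr_fun h y

/-- `Ext^1(L)` embeds in a quotient of the finitely generated `P₁^*`, and `B` is noetherian. -/
theorem extOne_finite [SMulCommClass B A D] (hD : IsDualizing A B D) [Module.Projective A P₀]
    [Module.Finite A P₁] [Module.Projective A P₁]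
    (h₂ : Function.Exact f₂ f₁) (h₁ : Function.Exact f₁ p) (hp : Function.Surjective p) :
    Module.Finite B (ExtGroup A D L 1) := by
  have := hD.right_noetherian
  obtain ⟨_, _⟩ := dual_finite_projective hD P₁
  obtain ⟨e⟩ := exists_extOne_equiv (B := B) (D := D) h₂ h₁ hp
  exact Module.Finite.equiv e.symm

/-- Two connecting maps are composed, along `0 → Ext^1(L) → Coker f₁^* → im f₂^* → 0` and `0 → im
f₂^* → P₂^* → Coker f₂^* → 0`. -/
theorem exists_ext_extOne_equiv [SMulCommClass B A D] (hD : IsDualizing A B D)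
    [Module.Finite A P₂] [Module.Projective A P₂]
    [Module.Finite A P₁] [Module.Projective A P₁] [Module.Finite A P₀] [Module.Projective A P₀]
    (h₂ : Function.Exact f₂ f₁) (h₁ : Function.Exact f₁ p) (hp : Function.Surjective p) {i j : ℕ}
    (hL : TransposeVanishing B D f₁ i) (hj : j < i) :
    Nonempty (ExtGroup B D (ExtGroup A D L 1) j ≃ₗ[A]
      ExtGroup B D (Transpose B D f₂) (j + 2)) := by
  obtain ⟨_, _⟩ := dual_finite_projective hD P₁
  obtain ⟨_, _⟩ := dual_finite_projective hD P₂
  obtain ⟨e⟩ := exists_extOne_equiv (B := B) (D := D) h₂ h₁ hp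
  have hi := Submodule.injective_subtype (transposeToRange B D h₂).ker
  have hex : Function.Exact (transposeToRange B D h₂).ker.subtype (transposeToRange B D h₂) := by
    rw [LinearMap.exact_iff, Submodule.range_subtype]
  have hpull : ∀ x : ExtGroup B D (Transpose B D f₁) j,
      extPull A (transposeToRange B D h₂).ker.subtype j x = 0 := by
    intro x
    -- In degree `0` the group for `Coker f₁^*` need not vanish, but its restriction does: a
    -- functional is evaluation at some `x` in the kernel of `f₁`, so at `f₂ y`, and `Ext^1(L)`
    -- consists of classes of `φ` with `φ ∘ f₂ = 0`.
    rcases j with _ | j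
    · obtain ⟨Φ, rfl⟩ := (homExtEquiv A _).surjective x
      rw [extPull_homExtEquiv, map_eq_zero_iff _ (homExtEquiv A _).injective]
      obtain ⟨x, hx⟩ := evalMap_surjective hD P₁ (Φ ∘ₗ (dualMap B D f₁).range.mkQ)
      have h0 : f₁ x = 0 := by
        refine isTorsionless_of_projective hD P₀ _ fun φ => ?_
        have h := LinearMap.congr_fun hx (dualMap B D f₁ φ)
        rw [LinearMap.comp_apply, show (dualMap B D f₁).range.mkQ (dualMap B D f₁ φ) = 0 from
          (Submodule.Quotient.mk_eq_zero _).2 ⟨φ, rfl⟩, map_zero] at h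
        exact h
      obtain ⟨y, rfl⟩ := (h₂ x).1 h0
      ext ⟨z, hz⟩
      obtain ⟨φ, rfl⟩ := Submodule.mkQ_surjective _ z
      have hφ : φ ∘ₗ f₂ = 0 := congrArg Subtype.val hz
      exact (LinearMap.congr_fun hx φ).symm.trans (LinearMap.congr_fun hφ y)
    · rw [(hL (j + 1) (by omega) (by omega)).elim x 0, map_zero]
  let c := LinearEquiv.ofBijective
    (extConn (D := D) A hi hex (transposeToRange_surjective h₂) j) ⟨by
      rw [injective_iff_map_eq_zero]
      intro y hy
      obtain ⟨x, rfl⟩ := exists_extPull_of_extConn A hi hex (transposeToRange_surjective h₂) y hy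
      exact hpull x, extConn_surjective A hi hex _ (hL (j + 1) (by omega) (by omega))⟩
  exact ⟨(extCongr A e j).trans (c.trans
    (extShift A (Submodule.injective_subtype (dualMap B D f₂).range)
        (exact_subtype_mkQ _) (Submodule.mkQ_surjective _) j))⟩

end ExtOne

theorem exact_subtype_ker {R M N : Type u} [Ring R] [AddCommGroup M] [Module R M]
    [AddCommGroup N] [Module R N] (f : M →ₗ[R] N) : Function.Exact f.ker.subtype f := by
  rw [LinearMap.exact_iff, Submodule.range_subtype]

theorem EX_subsingleton_of_subsingleton {A W Z : Type u} [Ring A] [AddCommGroup W] [Module A W]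
    [AddCommGroup Z] [Module A Z] [Subsingleton Z] (m : ℕ) : Subsingleton (EX A W Z m) := by
  refine subsingleton_of_forall_eq 0 fun a => ?_
  rw [← Abelian.Ext.comp_mk₀_id a,
    show 𝟙 (ModuleCat.of A Z) = 0 from by ext x; exact Subsingleton.elim (α := Z) _ _,
    Abelian.Ext.mk₀_zero, Abelian.Ext.comp_zero]

theorem extGrade_congr (A : Type u) {B D : Type u} [Ring A] [Ring B] [AddCommGroup D] [Module A D]
    [Module B D] [SMulCommClass B A D] {M N : Type u} [AddCommGroup M] [Module B M]
    [AddCommGroup N] [Module B N] (e : M ≃ₗ[B] N) : extGrade B D M = extGrade B D N := by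
  simp only [extGrade, (extCongr (D := D) A e _).toEquiv.nontrivial_congr]

section DualExact

variable {A B D : Type u} [Ring A] [Ring B] [AddCommGroup D] [Module A D] [Module B D]
  [SMulCommClass A B D] {F S : Type u} [AddCommGroup F] [Module A F] [AddCommGroup S] [Module A S]
  {p : F →ₗ[A] S}

theorem dualMap_injective (hp : Function.Surjective p) : Function.Injective (dualMap B D p) :=
  fun g g' h => by
    ext s
    obtain ⟨x, rfl⟩ := hp s
    exact LinearMap.congr_fun h x

theorem dualMap_exact (hp : Function.Surjective p) :
    Function.Exact (dualMap B D p) (dualMap B D p.ker.subtype) := by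
  intro φ
  constructor
  · intro hφ
    have hle : p.ker ≤ φ.ker := fun x hx => LinearMap.congr_fun hφ (⟨x, hx⟩ : p.ker)
    refine ⟨p.ker.liftQ φ hle ∘ₗ (p.quotKerEquivOfSurjective hp).symm.toLinearMap, ?_⟩
    ext x
    have : (p.quotKerEquivOfSurjective hp).symm (p x) = p.ker.mkQ x := by
      rw [LinearEquiv.symm_apply_eq]
      rfl
    exact congrArg (p.ker.liftQ φ hle) this
  · rintro ⟨g, rfl⟩
    ext x
    exact (congrArg g x.2).trans (map_zero g)

end DualExact

/-! ### The first possibly nonzero Ext group cannot have too large a grade -/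

section DoubleExt

variable {A B D : Type u} [Ring A] [Ring B] [AddCommGroup D] [Module A D] [Module B D]
  [SMulCommClass A B D] [SMulCommClass B A D]

variable (hD : IsDualizing A B D)

include hD

theorem hom_dual_subsingleton {S W : Type u} [AddCommGroup S] [Module A S] [Module.Finite A S]
    [AddCommGroup W] [Module B W] (hW : Subsingleton (ExtGroup B D W 0)) :
    Subsingleton (W →ₗ[B] (S →ₗ[A] D)) := by
  obtain ⟨F, p, _, _, hp⟩ := exists_projective_cover A S
  obtain ⟨_, _⟩ := dual_finite_projective hD F
  have := EX_zero_subsingleton_iff.1 (EX_subsingleton_projective hD.symm (F →ₗ[A] D) hW)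
  refine subsingleton_of_forall_eq 0 fun h => ?_
  ext w s
  obtain ⟨x, rfl⟩ := hp s
  exact LinearMap.congr_fun (LinearMap.congr_fun
    (Subsingleton.elim (dualMap B D p ∘ₗ h) 0) w) x

/-- Under the vanishing hypotheses, dualizing a projective resolution of `S` stays exact long enough
to shift `Hom(W, Ext^{n+1}(S))` down to groups `Ext^m(W, P^*)`, which vanish, and `Ext^m(W, S^*)`.
The hypothesis on `S^*` is what the induction carries to the syzygies of `S`. -/
theorem hom_ext_subsingleton {W : Type u} [AddCommGroup W] [Module B W] (n : ℕ) :
    ∀ (S : Type u) [AddCommGroup S] [Module A S] [Module.Finite A S],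
    (∀ j, 1 ≤ j → j ≤ n → Subsingleton (ExtGroup A D S j)) →
    (∀ m, m ≤ n + 1 → Subsingleton (ExtGroup B D W m)) →
    (∀ m, 2 ≤ m → m ≤ n + 2 → Subsingleton (EX B W (S →ₗ[A] D) m)) →
    Subsingleton (W →ₗ[B] ExtGroup A D S (n + 1)) := by
  have := hD.left_noetherian
  induction n with
  | zero =>
    intro S _ _ _ _ hW hS
    obtain ⟨F, p, _, _, hp⟩ := exists_projective_cover A S
    obtain ⟨_, _⟩ := dual_finite_projective hD F
    let ρ : (F →ₗ[A] D) →ₗ[B] (p.ker →ₗ[A] D) := dualMap B D p.ker.subtype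
    have hex : Function.Exact (dualMap B D p) ρ.rangeRestrict := by
      rw [LinearMap.exact_iff, LinearMap.ker_rangeRestrict]
      exact LinearMap.exact_iff.1 (dualMap_exact hp)
    -- The image of `ρ` is `F^*/S^*`, and `Ext^1(S)` is the cokernel of `ρ`.
    have hI : Subsingleton (EX B W ρ.range 1) :=
      EX_subsingleton_quotient (dualMap_injective hp) hex (LinearMap.surjective_rangeRestrict ρ) 1
        (EX_subsingleton_projective hD.symm _ (hW 1 le_rfl)) (hS 2 le_rfl le_rfl)
    have hi := Submodule.injective_subtype p.ker
    have hex' : Function.Exact ρ.range.subtype (homConn B hi (exact_subtype_ker p) hp) := by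
      intro g
      rw [homConn_eq_zero_iff]
      constructor
      · rintro ⟨g', rfl⟩
        exact ⟨⟨_, g', rfl⟩, rfl⟩
      · rintro ⟨⟨_, g', rfl⟩, rfl⟩
        exact ⟨g', rfl⟩
    exact EX_zero_subsingleton_iff.1 (EX_subsingleton_quotient (Submodule.injective_subtype _)
      hex' (homConn_surjective B _ _ _) 0
      (EX_zero_subsingleton_iff.2 (hom_dual_subsingleton hD (hW 0 (by omega)))) hI)
  | succ n ih =>
    intro S _ _ _ hE hW hS
    obtain ⟨F, p, _, _, hp⟩ := exists_projective_cover A S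
    obtain ⟨_, _⟩ := dual_finite_projective hD F
    let ρ : (F →ₗ[A] D) →ₗ[B] (p.ker →ₗ[A] D) := dualMap B D p.ker.subtype
    have hi := Submodule.injective_subtype p.ker
    have hρ : Function.Surjective ρ :=
      (ext_one_subsingleton_iff D B hi (exact_subtype_ker p) hp).1 (hE 1 le_rfl (by omega))
    -- Since `ρ` is onto, the dual of the kernel is `F^*/S^*`, so its Ext groups are controlled by
    -- those of `S^*` one degree higher.
    have ih := ih p.ker
      (fun j h1 h2 => by
        obtain ⟨j, rfl⟩ : ∃ i, j = i + 1 := ⟨j - 1, by omega⟩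
        exact (extShift B hi (exact_subtype_ker p) hp j).toEquiv.subsingleton_congr.2
          (hE (j + 2) (by omega) (by omega)))
      (fun m hm => hW m (by omega))
      (fun m h1 h2 => EX_subsingleton_quotient (dualMap_injective hp) (dualMap_exact hp) hρ m
        (EX_subsingleton_projective hD.symm _ (hW m (by omega))) (hS (m + 1) (by omega) (by omega)))
    refine subsingleton_of_forall_eq 0 fun h => ?_
    let c := extShift (D := D) B hi (exact_subtype_ker p) hp n
    ext w
    have := LinearMap.congr_fun (ih.elim (c.symm.toLinearMap ∘ₗ h) 0) w
    exact (map_eq_zero_iff c.symm c.symm.injective).1 this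

/-- If `Ext_A^j(S, D) = 0` for `j < g` and `Ext_A^g(S, D)` has grade greater than `g`, then
`Ext_A^g(S, D) = 0`. -/
theorem ext_subsingleton_of_grade (S : Type u) [AddCommGroup S] [Module A S] [Module.Finite A S]
    (g : ℕ) (hS : ∀ j < g, Subsingleton (ExtGroup A D S j))
    (hW : ∀ m ≤ g, Subsingleton (ExtGroup B D (ExtGroup A D S g) m)) :
    Subsingleton (ExtGroup A D S g) := by
  suffices h : Subsingleton (ExtGroup A D S g →ₗ[B] ExtGroup A D S g) from
    subsingleton_of_forall_eq 0 fun x => LinearMap.congr_fun (h.elim LinearMap.id 0) x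
  rcases g with _ | g
  · have h := hom_dual_subsingleton (S := S) hD (hW 0 le_rfl)
    refine subsingleton_of_forall_eq 0 fun f => ?_
    ext w
    have := LinearMap.congr_fun (h.elim ((homExtEquiv B S).symm.toLinearMap ∘ₗ f) 0) w
    exact (map_eq_zero_iff (homExtEquiv B S).symm (homExtEquiv B S).symm.injective).1 this
  · have h0 : Subsingleton (S →ₗ[A] D) :=
      (homExtEquiv B S).toEquiv.subsingleton_congr.2 (hS 0 (by omega))
    exact hom_ext_subsingleton hD g S (fun j _ h => hS j (by omega)) hW
      (fun m _ _ => EX_subsingleton_of_subsingleton m)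

end DoubleExt

/-! ### Grade conditions, torsionfreeness and left-right symmetry -/

section Equivalence

variable {A B D : Type u} [Ring A] [Ring B] [AddCommGroup D] [Module A D] [Module B D]
  [SMulCommClass A B D] [SMulCommClass B A D]

variable (A B D) in
/-- `grade Ext_A^{i+1}(M, D) ≥ i` for all finitely generated `M`. -/
def ExtGradeCondition (i : ℕ) : Prop :=
  ∀ (M : Type u) [AddCommGroup M] [Module A M] [Module.Finite A M],
    (i : ℕ∞) ≤ extGrade B D (ExtGroup A D M (i + 1))

-- Dimension shifting along the coresolution of `L`; `M` is its last cokernel. The degree `m` must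
-- vary in the induction.
omit [SMulCommClass B A D] in
variable (B D) in
theorem IterSyzygy.exists_ext_equiv (j : ℕ) : ∀ (L : ModuleCat.{u} A), Module.Finite A L →
    IterSyzygy A j L → ∀ m, ∃ M : ModuleCat.{u} A, Module.Finite A M ∧
      Nonempty (ExtGroup A D L (m + 1) ≃ₗ[B] ExtGroup A D M (j + m + 1)) := by
  induction j with
  | zero =>
    intro L hL _ m
    rw [Nat.zero_add]
    exact ⟨L, hL, ⟨LinearEquiv.refl _ _⟩⟩
  | succ j ih =>
    rintro L hL ⟨Q, N, ι, π, _, _, hι, hex, hπ, hN⟩ m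
    obtain ⟨M, hM, ⟨e⟩⟩ := ih N (Module.Finite.of_surjective π hπ) hN (m + 1)
    rw [show j + 1 + m + 1 = j + (m + 1) + 1 by omega]
    exact ⟨M, hM, ⟨(extShift B hι hex hπ m).trans e⟩⟩

omit [SMulCommClass B A D] in
variable (B D) in
theorem exists_iterSyzygy [IsNoetherianRing A] (j : ℕ) (M : Type u) [AddCommGroup M] [Module A M]
    [Module.Finite A M] : ∀ m, ∃ L : ModuleCat.{u} A, Module.Finite A L ∧ IterSyzygy A j L ∧
      Nonempty (ExtGroup A D L (m + 1) ≃ₗ[B] ExtGroup A D M (j + m + 1)) := by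
  induction j with
  | zero =>
    intro m
    rw [Nat.zero_add]
    exact ⟨ModuleCat.of A M, ‹_›, trivial, ⟨LinearEquiv.refl _ _⟩⟩
  | succ j ih =>
    intro m
    obtain ⟨L, _, hs, ⟨e⟩⟩ := ih (m + 1)
    obtain ⟨P, p, _, _, hp⟩ := exists_projective_cover A L
    have hi := Submodule.injective_subtype p.ker
    rw [show j + 1 + m + 1 = j + (m + 1) + 1 by omega]
    exact ⟨ModuleCat.of A p.ker, inferInstanceAs (Module.Finite A p.ker),
      ⟨P, L, p.ker.subtype, p, ‹_›, ‹_›, hi, exact_subtype_ker p, hp, hs⟩,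
      ⟨(extShift B hi (exact_subtype_ker p) hp m).trans e⟩⟩

theorem exists_presentation [IsNoetherianRing A] (M : Type u) [AddCommGroup M] [Module A M]
    [Module.Finite A M] : ∃ (P₁ P₀ : ModuleCat.{u} A) (f : P₁ →ₗ[A] P₀) (p : P₀ →ₗ[A] M),
      Module.Finite A P₁ ∧ Module.Projective A P₁ ∧ Module.Finite A P₀ ∧ Module.Projective A P₀ ∧
      Function.Exact f p ∧ Function.Surjective p := by
  obtain ⟨P₀, p, _, _, hp⟩ := exists_projective_cover A M
  obtain ⟨P₁, q, _, _, hq⟩ := exists_projective_cover A p.ker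
  refine ⟨P₁, P₀, p.ker.subtype ∘ₗ q, p, ‹_›, ‹_›, ‹_›, ‹_›, ?_, hp⟩
  rw [LinearMap.exact_iff, LinearMap.range_comp_of_range_eq_top _ (LinearMap.range_eq_top.2 hq),
    Submodule.range_subtype]

variable (hD : IsDualizing A B D)

include hD

/-- For a short exact sequence `0 → M → Q → N → 0` with `Q` finitely generated projective and `N`
torsionfree, a transpose `Y` of `M` satisfies `Ext^{j+2}(Y, D) ≃ Ext^j(Ext^1(N, D), D)` in low
degrees. -/
theorem exists_transpose {M Q N : Type u} [AddCommGroup M] [Module A M] [Module.Finite A M]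
    [AddCommGroup Q] [Module A Q] [Module.Finite A Q] [Module.Projective A Q]
    [AddCommGroup N] [Module A N] {ι : M →ₗ[A] Q} {π : Q →ₗ[A] N} (hι : Function.Injective ι)
    (hex : Function.Exact ι π) (hπ : Function.Surjective π) {i : ℕ}
    (hN : IsTorsionfree A B D i N) :
    ∃ Y : ModuleCat.{u} B, Module.Finite B Y ∧ Module.Finite B (ExtGroup A D N 1) ∧
      (∀ k, IsTorsionfree A B D k M ↔
        ∀ j, 1 ≤ j → j ≤ k → Subsingleton (ExtGroup B D Y j)) ∧
      Subsingleton (ExtGroup B D Y 1) ∧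
      ∀ j < i, Nonempty (ExtGroup B D (ExtGroup A D N 1) j ≃ₗ[A] ExtGroup B D Y (j + 2)) := by
  have := hD.left_noetherian
  obtain ⟨P₂, P₁, f₂, q, _, _, _, _, h₂, hq⟩ := exists_presentation (A := A) M
  obtain ⟨_, _⟩ := dual_finite_projective hD P₂
  -- Splicing with `ι` makes `f₂` at once a presentation of `M` and the second map of a resolution
  -- `P₂ → P₁ → Q → N`.
  have h₂' : Function.Exact f₂ (ι ∘ₗ q) := by
    rw [LinearMap.exact_iff] at h₂ ⊢
    rw [← h₂]
    exact LinearMap.ker_comp_of_ker_eq_bot _ (LinearMap.ker_eq_bot.2 hι)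
  have h₁ : Function.Exact (ι ∘ₗ q) π := by
    rw [LinearMap.exact_iff] at hex ⊢
    rw [hex]
    exact (LinearMap.range_comp_of_range_eq_top _ (LinearMap.range_eq_top.2 hq)).symm
  have hN' := (isTorsionfree_iff hD h₁ hπ i).1 hN
  exact ⟨ModuleCat.of B (Transpose B D f₂),
    inferInstanceAs (Module.Finite B (Transpose B D f₂)), extOne_finite hD h₂' h₁ hπ,
    fun k => isTorsionfree_iff hD h₂ hq k,
    transposeVanishing_one_of_isTorsionless hD h₂
      ((isTorsionless_of_projective hD Q).of_injective ι hι) 1 le_rfl le_rfl,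
    fun j hj => exists_ext_extOne_equiv hD h₂' h₁ hπ hN' hj⟩

/-- Degree `1` of the transpose is free because `M` embeds in `Q`; degrees `2` to `i + 1` are
degrees `0` to `i - 1` of `Ext^1(N)`. -/
theorem isTorsionfree_succ_iff {M Q N : Type u} [AddCommGroup M] [Module A M] [Module.Finite A M]
    [AddCommGroup Q] [Module A Q] [Module.Finite A Q] [Module.Projective A Q]
    [AddCommGroup N] [Module A N] {ι : M →ₗ[A] Q} {π : Q →ₗ[A] N} (hι : Function.Injective ι)
    (hex : Function.Exact ι π) (hπ : Function.Surjective π) {i : ℕ}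
    (hN : IsTorsionfree A B D i N) :
    IsTorsionfree A B D (i + 1) M ↔ (i : ℕ∞) ≤ extGrade B D (ExtGroup A D N 1) := by
  obtain ⟨Y, -, -, hY, hY1, e⟩ := exists_transpose hD hι hex hπ hN
  rw [hY, le_extGrade_iff]
  constructor
  · intro h t ht
    obtain ⟨e⟩ := e t ht
    exact e.toEquiv.subsingleton_congr.2 (h (t + 2) (by omega) (by omega))
  · intro h j h1 h2
    rcases j with _ | _ | j
    · omega
    · exact hY1
    · obtain ⟨e⟩ := e j (by omega)
      exact e.toEquiv.subsingleton_congr.1 (h j (by omega))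

theorem isTorsionfree_of_iterSyzygy {k : ℕ}
    (h : ∀ j, 1 ≤ j → j < k → ExtGradeCondition A B D j) (i : ℕ) :
    i ≤ k → ∀ M : ModuleCat.{u} A, Module.Finite A M → IterSyzygy A i M →
      IsTorsionfree A B D i M := by
  have := hD.left_noetherian
  induction i with
  | zero =>
    intro _ M _ _
    obtain ⟨P₁, P₀, f, p, h1, h2, h3, h4, h5, h6⟩ := exists_presentation (A := A) M
    exact ⟨P₁, P₀, f, p, h1, h2, h3, h4, h5, h6, fun i _ _ => by omega⟩
  | succ i ih =>
    rintro hik M _ ⟨Q, N, ι, π, _, _, hι, hex, hπ, hN⟩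
    have hNf : Module.Finite A N := Module.Finite.of_surjective π hπ
    rw [isTorsionfree_succ_iff hD hι hex hπ (ih (by omega) N hNf hN)]
    obtain ⟨M', _, ⟨e⟩⟩ := hN.exists_ext_equiv B D i N hNf 0
    rw [extGrade_congr A e]
    -- The first step needs no hypothesis: a grade is always at least `0`.
    rcases i with _ | i
    · exact zero_le
    · exact h (i + 1) (by omega) (by omega) M'

theorem extGradeCondition_of_isTorsionfree {i : ℕ}
    (h : ∀ j, i ≤ j → j ≤ i + 1 → ∀ M : ModuleCat.{u} A, Module.Finite A M → IterSyzygy A j M →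
      IsTorsionfree A B D j M) : ExtGradeCondition A B D i := by
  intro M _ _ _
  have := hD.left_noetherian
  obtain ⟨L, _, hL, ⟨e⟩⟩ := exists_iterSyzygy (A := A) B D i M 0
  obtain ⟨P, p, _, _, hp⟩ := exists_projective_cover A L
  have hi := Submodule.injective_subtype p.ker
  have hs : IterSyzygy A (i + 1) (ModuleCat.of A p.ker) :=
    ⟨P, L, p.ker.subtype, p, ‹_›, ‹_›, hi, exact_subtype_ker p, hp, hL⟩
  rw [← extGrade_congr A e]
  exact (isTorsionfree_succ_iff hD hi (exact_subtype_ker p) hp (h i le_rfl (by omega) L ‹_› hL)).1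
    (h (i + 1) (by omega) le_rfl _ (inferInstanceAs (Module.Finite A p.ker)) hs)

theorem ExtGradeCondition.symm (i : ℕ) (h : ∀ j, 1 ≤ j → j ≤ i → ExtGradeCondition B A D j) :
    ∀ j, 1 ≤ j → j ≤ i → ExtGradeCondition A B D j := by
  intro j
  induction j using Nat.strong_induction_on with
  | _ j ih =>
    intro h1 hji M _ _ _
    have := hD.left_noetherian
    have htf := isTorsionfree_of_iterSyzygy hD (k := j)
      (fun t ht htj => ih t htj ht (by omega)) j le_rfl
    obtain ⟨L, _, hL, ⟨e⟩⟩ := exists_iterSyzygy (A := A) B D j M 0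
    obtain ⟨P, p, _, _, hp⟩ := exists_projective_cover A L
    have hi := Submodule.injective_subtype p.ker
    have hs : IterSyzygy A (j + 1) (ModuleCat.of A p.ker) :=
      ⟨P, L, p.ker.subtype, p, ‹_›, ‹_›, hi, exact_subtype_ker p, hp, hL⟩
    obtain ⟨Y, _, _, hY, -, hE⟩ :=
      exists_transpose hD hi (exact_subtype_ker p) hp (htf L ‹_› hL)
    -- Only the conditions below `j` are available, so `p.ker` is used as a `j`-fold syzygy although
    -- it is a `(j + 1)`-fold one. This handles all degrees of `Ext^1(L)` except `j - 1`.
    have hY := (hY j).1 (htf _ (inferInstanceAs (Module.Finite A p.ker)) hs.pred)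
    rw [← extGrade_congr A e, le_extGrade_iff]
    have hlow : ∀ t, t + 1 < j → Subsingleton (ExtGroup B D (ExtGroup A D L 1) t) := by
      intro t ht
      obtain ⟨c⟩ := hE t (by omega)
      exact c.toEquiv.subsingleton_congr.2 (hY (t + 2) (by omega) (by omega))
    intro t ht
    by_cases htj : t + 1 < j
    · exact hlow t htj
    · obtain rfl : j = t + 1 := by omega
      obtain ⟨c⟩ := hE t ht
      -- In the last degree, `c` identifies the group with `Ext^{t+2}(Y)`, to which the condition on
      -- the other side applies.
      refine ext_subsingleton_of_grade hD.symm _ t (fun m hm => hlow m (by omega)) fun m hm => ?_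
      have hg := h (t + 1) h1 hji Y
      rw [← extGrade_congr B c, le_extGrade_iff] at hg
      exact hg m (by omega)

theorem syzygies_eq_torsionfrees_iff (k : ℕ) :
    (∀ i, 1 ≤ i → i ≤ k → syzygies A i = torsionfrees A B D i) ↔
      ∀ i, 1 ≤ i → i ≤ k - 1 → ExtGradeCondition A B D i := by
  constructor
  · intro h i h1 h2
    refine extGradeCondition_of_isTorsionfree hD fun j hj1 hj2 M hM hs => ?_
    have := h j (by omega) (by omega)
    obtain ⟨j, rfl⟩ : ∃ t, j = t + 1 := ⟨j - 1, by omega⟩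
    have hs : syzygies A (j + 1) M := ⟨hM, isSyzygy_of_iterSyzygy j M hs⟩
    rw [this] at hs
    exact hs.2
  · intro h i h1 h2
    obtain ⟨i, rfl⟩ : ∃ t, i = t + 1 := ⟨i - 1, by omega⟩
    ext M
    constructor
    · rintro ⟨hM, hs⟩
      exact ⟨hM, isTorsionfree_of_iterSyzygy hD (k := k) (fun j hj1 hj2 => h j hj1 (by omega))
        (i + 1) h2 M hM (iterSyzygy_of_isSyzygy i M hs)⟩
    · rintro ⟨hM, ht⟩
      exact ⟨hM, isSyzygy_of_iterSyzygy i M (ht.iterSyzygy hD)⟩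

end Equivalence

/-! ### Specialization to the ring itself -/

theorem isDualizing_self (Λ : Type u) [Ring Λ] [IsNoetherianRing Λ] [IsNoetherianRing Λᵐᵒᵖ] :
    IsDualizing Λ Λᵐᵒᵖ Λ := by
  refine ⟨⟨1, ?_, ?_⟩, inferInstance, inferInstance⟩
  · simpa [Function.id_def] using Function.bijective_id (α := Λ)
  · simpa using MulOpposite.unop_bijective

end SyzygyTorsionfree

open SyzygyTorsionfree in
theorem theorem2p4 (Λ : Type u) [Ring Λ] [IsNoetherianRing Λ] [IsNoetherianRing Λᵐᵒᵖ]
    (k : ℕ) (hk : 1 ≤ k) :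
    List.TFAE [
      ∀ (M : Type u) [AddCommGroup M] [Module Λ M] [Module.Finite Λ M] (i : ℕ),
        1 ≤ i → i ≤ k - 1 → (i : ℕ∞) ≤ extGrade Λᵐᵒᵖ Λ (ExtGroup Λ Λ M (i + 1)),
      ∀ i : ℕ, 1 ≤ i → i ≤ k → syzygies Λ i = torsionfrees Λ Λᵐᵒᵖ Λ i,
      ∀ (N : Type u) [AddCommGroup N] [Module Λᵐᵒᵖ N] [Module.Finite Λᵐᵒᵖ N] (i : ℕ),
        1 ≤ i → i ≤ k - 1 → (i : ℕ∞) ≤ extGrade Λ Λ (ExtGroup Λᵐᵒᵖ Λ N (i + 1)),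
      ∀ i : ℕ, 1 ≤ i → i ≤ k → syzygies Λᵐᵒᵖ i = torsionfrees Λᵐᵒᵖ Λ Λ i] := by
  have hD := isDualizing_self Λ
  tfae_have 1 ↔ 2 := by
    rw [syzygies_eq_torsionfrees_iff hD]
    exact ⟨fun h i h1 h2 M _ _ _ => h M i h1 h2, fun h M _ _ _ i h1 h2 => h i h1 h2 M⟩
  tfae_have 3 ↔ 4 := by
    rw [syzygies_eq_torsionfrees_iff hD.symm]
    exact ⟨fun h i h1 h2 M _ _ _ => h M i h1 h2, fun h M _ _ _ i h1 h2 => h i h1 h2 M⟩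
  tfae_have 1 → 3 := fun h M _ _ _ i h1 h2 =>
    ExtGradeCondition.symm hD.symm (k - 1) (fun j hj1 hj2 N _ _ _ => h N j hj1 hj2) i h1 h2 M
  tfae_have 3 → 1 := fun h M _ _ _ i h1 h2 =>
    ExtGradeCondition.symm hD (k - 1) (fun j hj1 hj2 N _ _ _ => h N j hj1 hj2) i h1 h2 M
  tfae_finish
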